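/- Let $\mathcal F_{op}$ be the set of functions $f:(0,\infty)\to(0,\infty)$ that are operator monotone and satisfy $f(t)=t f(t^{-1})$ for all $t>0$ and $f(1)=1$. Put $f(0)=\lim_{t\downarrow 0}f(t)$, and call $f$ regular if $f(0)>0$. The Morozova–Chentsov function associated with $f$ is $$c(x,y)=\frac{1}{y f(x/y)},\qquad x,y>0 .$$ For a positive definite density matrix $\rho$ on a finite-dimensional Hilbert space, let $L_\rho,R_\rho$ denote left and right multiplication by $\rho$, let $K^c_\rho(X,Y)=\operatorname{Tr}X^*c(L_\rho,R_\rho)Y$, and define, for regular $f$, the metric adjusted skew information of an observable (self-adjoint operator) $A$ by $$I^c_\rho(A)=\frac{f(0)}{2}K^c_\rho\big(i[\rho,A],i[\rho,A]\big)=\frac{f(0)}{2}\operatorname{Tr}A\,\hat c(L_\rho,R_\rho)A,\qquad \hat c(x,y)=(x-y)^2c(x,y).$$ It is extended to arbitrary (positive semi-definite) density matrices $\rho$ through the continuous extension of $\hat c$ to $[0,\infty)\times[0,\infty)$, for which $\hat c(x,0)=\hat c(0,x)=x/f(0)$. Let $H_1,H_2$ be finite-dimensional Hilbert spaces. A state (density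 matrix) $\rho$ on $H_1\otimes H_2$ is called semi-quantum if there is a resolution of the identity $\{P_i\}_{i\in I}$ in one-dimensional orthogonal projections, either on $H_1$ with $\sum_{i}(P_i\otimes\mathbf 1_2)\rho(P_i\otimes\mathbf 1_2)=\rho$, or on $H_2$ with $\sum_{i}(\mathbf 1_1\otimes P_i)\rho(\mathbf 1_1\otimes P_i)=\rho$. **Theorem.** Let $f\in\mathcal F_{op}$ be regular with associated Morozova–Chentsov function $c$, and let $\rho$ be a semi-quantum state on $H_1\otimes H_2$ with partial traces $\rho_1=\operatorname{Tr}_2\rho$ on $H_1$ and $\rho_2=\operatorname{Tr}_1\rho$ on $H_2$. Then $$I^c_\rho(A\otimes\mathbf 1_2+\mathbf 1_1\otimes B)\ \ge\ I^c_{\rho_1}(A)+I^c_{\rho_2}(B)$$ for every observable $A$ on $H_1$ and every observable $B$ on $H_2$. -/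

import Mathlib

open scoped Kronecker Matrix ComplexOrder

noncomputable section

namespace SkewInfo

/-! ### Operator monotone functions -/

/-- `f : (0,∞) → ℝ` is operator monotone: for positive definite matrices `A ≤ B` of any size,
`f(A) ≤ f(B)`. Only the values of `f` on `(0,∞)` matter. -/
def OperatorMonotone (f : ℝ → ℝ) : Prop :=
  ∀ (n : ℕ) (A B : Matrix (Fin n) (Fin n) ℂ), A.PosDef → B.PosDef →
    (B - A).PosSemidef → (cfc f B - cfc f A).PosSemidef

/-- The class `F_op` of functions `f : (0,∞) → (0,∞)`. -/
structure IsFop (f : ℝ → ℝ) : Prop where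
  pos : ∀ t : ℝ, 0 < t → 0 < f t
  operatorMonotone : OperatorMonotone f
  symm : ∀ t : ℝ, 0 < t → f t = t * f t⁻¹
  map_one : f 1 = 1

/-- The value `f(0)` of the continuous extension of `f` to `[0,∞)`, that is, the limit of `f(t)`
as `t` decreases to `0`. This is also the metric constant `m(c)`. -/
def zeroValue (f : ℝ → ℝ) : ℝ := Function.rightLim f 0

/-- `f` is regular if `f(0) > 0`. -/
def IsRegular (f : ℝ → ℝ) : Prop := 0 < zeroValue f

/-- The Morozova-Chentsov function `c(x,y) = 1 / (y f(x/y))`, for `x, y > 0`. -/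
def morozovaChentsov (f : ℝ → ℝ) (x y : ℝ) : ℝ := 1 / (y * f (x / y))

/-- The continuous extension of the Morozova-Chentsov function to
`{x ≥ 0, y ≥ 0, (x,y) ≠ (0,0)}`: `c(x,0) = c(0,x) = 1 / (x f(0))` for `x > 0`
(because `y f(x/y) = x f(y/x)`). The value at `(0,0)` is immaterial, as
the extension is only used through `(x - y)² c(x,y)`, which tends to `0` at `(0,0)`. -/
def morozovaChentsovExt (f : ℝ → ℝ) (x y : ℝ) : ℝ :=
  if x = 0 ∨ y = 0 then 1 / ((x + y) * zeroValue f) else morozovaChentsov f x y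

/-! ### Monotone metrics and metric adjusted skew information -/

section Metric

variable {n : Type*} [Fintype n] [DecidableEq n]

/-- `c(L_ρ, R_ρ) X` for the commuting left and right multiplication operators `L_ρ`, `R_ρ`
by a Hermitian matrix `ρ = U diag(λ) U*`: in an eigenbasis of `ρ` the entry `X i j` is multiplied by
`c (λ i) (λ j)`. -/
def leftRightCalculus (c : ℝ → ℝ → ℝ) {ρ : Matrix n n ℂ} (hρ : ρ.IsHermitian)
    (X : Matrix n n ℂ) : Matrix n n ℂ :=
  let U : Matrix n n ℂ := (hρ.eigenvectorUnitary : Matrix n n ℂ)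
  U * (Matrix.of (fun i j => (c (hρ.eigenvalues i) (hρ.eigenvalues j) : ℂ)) ⊙ (Uᴴ * X * U)) * Uᴴ

/-- `K^c_ρ(A,B) = Tr A* c(L_ρ,R_ρ) B`. -/
def monotoneMetric (c : ℝ → ℝ → ℝ) {ρ : Matrix n n ℂ} (hρ : ρ.IsHermitian)
    (A B : Matrix n n ℂ) : ℂ :=
  (Aᴴ * leftRightCalculus c hρ B).trace

/-- States (density matrices). -/
structure State (n : Type*) [Fintype n] [DecidableEq n] where
  toMatrix : Matrix n n ℂ
  posSemidef : toMatrix.PosSemidef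
  trace_eq_one : toMatrix.trace = 1

/-- The metric adjusted skew information
`I^c_ρ(A) = (f(0)/2) K^c_ρ(i[ρ,A], i[ρ,A])` of a state `ρ`, where `c` is the Morozova-Chentsov
function of `f`. For singular `ρ` the boundary values of `c` enter; for positive definite `ρ` they
do not, see `skewInformation_eq_of_posDef`. -/
def skewInformation (f : ℝ → ℝ) (ρ : State n) (A : Matrix n n ℂ) : ℝ :=
  zeroValue f / 2 *
    (monotoneMetric (morozovaChentsovExt f) ρ.posSemidef.isHermitian
      (Complex.I • (ρ.toMatrix * A - A * ρ.toMatrix))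
      (Complex.I • (ρ.toMatrix * A - A * ρ.toMatrix))).re

theorem skewInformation_eq_of_posDef (f : ℝ → ℝ) (ρ : State n) (hρ : ρ.toMatrix.PosDef)
    (A : Matrix n n ℂ) :
    skewInformation f ρ A = zeroValue f / 2 *
      (monotoneMetric (morozovaChentsov f) hρ.isHermitian
        (Complex.I • (ρ.toMatrix * A - A * ρ.toMatrix))
        (Complex.I • (ρ.toMatrix * A - A * ρ.toMatrix))).re := by
  have h : ∀ i j, morozovaChentsovExt f (hρ.isHermitian.eigenvalues i)
      (hρ.isHermitian.eigenvalues j) = morozovaChentsov f (hρ.isHermitian.eigenvalues i)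
      (hρ.isHermitian.eigenvalues j) := fun i j => by
    simp [morozovaChentsovExt, (hρ.eigenvalues_pos i).ne', (hρ.eigenvalues_pos j).ne']
  simp only [skewInformation, monotoneMetric, leftRightCalculus, h]

end Metric

/-! ### Bipartite systems -/

section Bipartite

variable {m n : Type*} [Fintype m] [DecidableEq m] [Fintype n] [DecidableEq n]

/-- The partial trace over the second party. -/
def partialTrace₂ (X : Matrix (m × n) (m × n) ℂ) : Matrix m m ℂ :=
  Matrix.of fun i j => ∑ k, X (i, k) (j, k)

/-- The partial trace over the first party. -/
def partialTrace₁ (X : Matrix (m × n) (m × n) ℂ) : Matrix n n ℂ :=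
  Matrix.of fun i j => ∑ k, X (k, i) (k, j)

/-- The reduced state `ρ₁ = Tr₂ ρ` of the first party. -/
def State.reduced₁ (ρ : State (m × n)) : State m where
  toMatrix := partialTrace₂ ρ.toMatrix
  posSemidef := by
    have h : partialTrace₂ ρ.toMatrix =
        ∑ k, ρ.toMatrix.submatrix (fun i : m => (i, k)) (fun i : m => (i, k)) := by
      ext i j
      simp [partialTrace₂, Matrix.sum_apply]
    rw [h]
    exact Matrix.posSemidef_sum _ fun k _ => ρ.posSemidef.submatrix _
  trace_eq_one := by
    rw [← ρ.trace_eq_one]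
    simp [partialTrace₂, Matrix.trace, Fintype.sum_prod_type]

/-- The reduced state `ρ₂ = Tr₁ ρ` of the second party. -/
def State.reduced₂ (ρ : State (m × n)) : State n where
  toMatrix := partialTrace₁ ρ.toMatrix
  posSemidef := by
    have h : partialTrace₁ ρ.toMatrix =
        ∑ k, ρ.toMatrix.submatrix (fun i : n => (k, i)) (fun i : n => (k, i)) := by
      ext i j
      simp [partialTrace₁, Matrix.sum_apply]
    rw [h]
    exact Matrix.posSemidef_sum _ fun k _ => ρ.posSemidef.submatrix _
  trace_eq_one := by
    rw [← ρ.trace_eq_one]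
    simp [partialTrace₁, Matrix.trace, Fintype.sum_prod_type_right]

/-- `(P i)` is a resolution of the identity in one-dimensional orthogonal projections. -/
structure IsVonNeumannMeasurement {ι : Type*} [Fintype ι] (P : ι → Matrix m m ℂ) : Prop where
  isStarProjection : ∀ i, IsStarProjection (P i)
  rank_eq_one : ∀ i, (P i).rank = 1
  sum_eq_one : ∑ i, P i = 1

/-- A state is semi-quantum if it is left invariant by some local von Neumann measurement of the
first party or of the second party. -/
def State.IsSemiQuantum (ρ : State (m × n)) : Prop :=
  (∃ (k : ℕ) (P : Fin k → Matrix m m ℂ), IsVonNeumannMeasurement P ∧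
    ∑ i, (P i ⊗ₖ (1 : Matrix n n ℂ)) * ρ.toMatrix * (P i ⊗ₖ (1 : Matrix n n ℂ)) = ρ.toMatrix) ∨
  (∃ (k : ℕ) (Q : Fin k → Matrix n n ℂ), IsVonNeumannMeasurement Q ∧
    ∑ i, ((1 : Matrix m m ℂ) ⊗ₖ Q i) * ρ.toMatrix * ((1 : Matrix m m ℂ) ⊗ₖ Q i) = ρ.toMatrix)

end Bipartite

end SkewInfo

end

/-!
Write `m(x,y) = y f(x/y)`, so that `c = 1/m`, and let `L`, `R` be left and right multiplication by
a state. The inequality splits into two facts.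

*Additivity for semi-quantum states.* If `ρ` commutes with the projections `P i ⊗ 1`, then
`[ρ, 1 ⊗ B]` is block diagonal for them. As `P i` has rank one, the diagonal blocks of `A ⊗ 1` are
multiples of `P i ⊗ 1`, and so `[ρ, A ⊗ 1]` is off-diagonal. The operator `c(L_ρ, R_ρ)` preserves
blocks, so the cross terms in `I_ρ(A ⊗ 1 + 1 ⊗ B)` vanish
(`State.IsSemiQuantum.skewInformation_add`).

*Monotonicity under restriction.* For every state, `I_{ρ₁}(A) ≤ I_ρ(A ⊗ 1)`, and likewise for the
second party. More generally this holds for the restriction `σ` of `ρ` along a unital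
`*`-homomorphism `Φ` of matrix algebras (`skewInformation_le_of_restriction`), by Petz's argument.
The map `Z ↦ Φ(Z σ^{-1/2}) ρ^{1/2}` is an isometry `W` for the Hilbert-Schmidt inner products, and
`W* (L_ρ R_ρ⁻¹) W = L_σ R_σ⁻¹`. Jensen's inequality `W* f(Δ) W ≤ f(W* Δ W)` for operator monotone
`f` (`IsFop.sum_map_mul_norm_sq_le`) then gives `Φ* m(L_ρ, R_ρ) Φ ≤ m(L_σ, R_σ)` (`IsFop.petz`).
The inequality between skew informations follows by duality, since the quadratic form of
`c = 1/m` is the Legendre transform of that of `m` (`IsFop.sum_inv_mean_le`).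

All of this is carried out in eigenbases of `ρ` and `σ`, where the multiplication operators are
diagonal on matrix units and only diagonal operators need a functional calculus. Singular states
are reached as limits of `ρ + ε 1`, along which the boundary values of `m` are the limits of its
values in the interior. The symmetry `f(t) = t f(1/t)` gives `f(s t) ≤ s f(t)` for `s ≥ 1`, which
provides the continuity of `f` and lets the error in Jensen's inequality tend to zero.
-/

open scoped Kronecker Matrix ComplexOrder

namespace SkewInfo

open Filter Topology Matrix Unitary

/-! ### Functions in the class `F_op` -/

/-- The mean `m(x,y) = y f(x/y)`, with the boundary values `m(x,0) = m(0,x) = x f(0)`. -/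
noncomputable def mean (f : ℝ → ℝ) (x y : ℝ) : ℝ :=
  if x = 0 ∨ y = 0 then (x + y) * zeroValue f else y * f (x / y)

/-- This includes the point `(0,0)`, where the mean vanishes and both sides are `0` by the
convention on division by zero. -/
theorem morozovaChentsovExt_eq_inv_mean (f : ℝ → ℝ) (x y : ℝ) :
    morozovaChentsovExt f x y = (mean f x y)⁻¹ := by
  unfold morozovaChentsovExt mean morozovaChentsov
  split_ifs <;> simp

/-- The functional calculus intertwines whatever the matrix itself intertwines with a diagonal
matrix. -/
theorem cfc_mul_of_mul_eq_mul_diagonal {α β : Type*} [Fintype α] [DecidableEq α] [Fintype β]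
    [DecidableEq β] (f : ℝ → ℝ) {Y : Matrix α α ℂ} (hY : Y.IsHermitian) {W : Matrix α β ℂ}
    {g : β → ℝ} (h : Y * W = W * diagonal (fun b => (g b : ℂ))) :
    cfc f Y * W = W * diagonal (fun b => (f (g b) : ℂ)) := by
  set U : Matrix α α ℂ := (hY.eigenvectorUnitary : Matrix α α ℂ) with hU
  have hUU : star U * U = 1 := Unitary.coe_star_mul_self hY.eigenvectorUnitary
  have hUU' : U * star U = 1 := Unitary.coe_mul_star_self hY.eigenvectorUnitary
  have hs : Y = U * diagonal (fun a => (hY.eigenvalues a : ℂ)) * star U := by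
    have := hY.spectral_theorem
    rw [Unitary.conjStarAlgAut_apply] at this
    exact this
  have hf : cfc f Y = U * diagonal (fun a => (f (hY.eigenvalues a) : ℂ)) * star U := by
    rw [hY.cfc_eq, Matrix.IsHermitian.cfc, Unitary.conjStarAlgAut_apply]
    rfl
  have key : diagonal (fun a => (hY.eigenvalues a : ℂ)) * (star U * W) =
      (star U * W) * diagonal (fun b => (g b : ℂ)) := by
    calc _ = star U * (U * diagonal (fun a => (hY.eigenvalues a : ℂ)) * star U * W) := by
          simp only [← Matrix.mul_assoc, hUU, Matrix.one_mul]
      _ = _ := by rw [← hs, h, Matrix.mul_assoc]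
  have key' : diagonal (fun a => (f (hY.eigenvalues a) : ℂ)) * (star U * W) =
      (star U * W) * diagonal (fun b => (f (g b) : ℂ)) := by
    ext a b
    have := congrFun (congrFun key a) b
    simp only [diagonal_mul, mul_diagonal] at this ⊢
    by_cases h0 : (star U * W) a b = 0
    · simp [h0]
    · rw [mul_comm] at this
      have := Complex.ofReal_injective (mul_left_cancel₀ h0 this)
      rw [this, mul_comm]
  rw [hf, Matrix.mul_assoc, Matrix.mul_assoc, key', ← Matrix.mul_assoc, ← Matrix.mul_assoc, hUU',
    Matrix.one_mul]

theorem cfc_diagonal {α : Type*} [Fintype α] [DecidableEq α] (f : ℝ → ℝ) (d : α → ℝ) :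
    cfc f (diagonal (fun a => (d a : ℂ))) = diagonal (fun a => (f (d a) : ℂ)) := by
  have hd : (diagonal (fun a => (d a : ℂ))).IsHermitian :=
    isHermitian_diagonal_of_self_adjoint _ (by ext; simp)
  simpa using cfc_mul_of_mul_eq_mul_diagonal f hd (W := 1) (g := d) (by simp)

section Scalar

variable {f : ℝ → ℝ}

theorem IsFop.monotoneOn (hf : IsFop f) : MonotoneOn f (Set.Ioi 0) := by
  intro s hs t ht hst
  have hs' : (0 : ℝ) < s := hs
  have ht' : (0 : ℝ) < t := ht
  have h := hf.operatorMonotone 1 (diagonal fun _ => (s : ℂ)) (diagonal fun _ => (t : ℂ))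
    (PosDef.diagonal fun _ => by simpa using hs') (PosDef.diagonal fun _ => by simpa using ht')
    (by
      rw [diagonal_sub]
      exact PosSemidef.diagonal fun _ => by simpa [← Complex.ofReal_sub] using hst)
  rw [cfc_diagonal, cfc_diagonal, diagonal_sub, posSemidef_diagonal_iff] at h
  have := h 0
  rw [← Complex.ofReal_sub, ← Complex.ofReal_zero, Complex.real_le_real] at this
  linarith

/-- By the symmetry `f(t) = t f(1/t)`, the function `f(t)/t` is decreasing. -/
theorem IsFop.map_mul_le (hf : IsFop f) {s t : ℝ} (hs : 1 ≤ s) (ht : 0 < t) :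
    f (s * t) ≤ s * f t := by
  have hs0 : 0 < s := by linarith
  rw [hf.symm _ (mul_pos hs0 ht), hf.symm t ht, mul_assoc]
  have : f (s * t)⁻¹ ≤ f t⁻¹ :=
    hf.monotoneOn (Set.mem_Ioi.2 (by positivity)) (Set.mem_Ioi.2 (by positivity))
      (inv_anti₀ ht (by nlinarith))
  gcongr

theorem IsFop.tendsto_zeroValue (hf : IsFop f) : Tendsto f (𝓝[>] 0) (𝓝 (zeroValue f)) := by
  have h := hf.monotoneOn.tendsto_nhdsGT
    ⟨0, by rintro _ ⟨t, ht, rfl⟩; exact (hf.pos t ht).le⟩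
  exact tendsto_rightLim_of_tendsto ⟨_, h⟩

theorem IsFop.continuousAt (hf : IsFop f) {t : ℝ} (ht : 0 < t) : ContinuousAt f t := by
  have hpos : ∀ᶠ s in 𝓝 t, 0 < s := lt_mem_nhds ht
  have hlo : Tendsto (fun s => min 1 (s / t) * f t) (𝓝 t) (𝓝 (f t)) := by
    have : ContinuousAt (fun s => min 1 (s / t) * f t) t := by fun_prop
    simpa [ContinuousAt, div_self ht.ne'] using this
  have hhi : Tendsto (fun s => max 1 (s / t) * f t) (𝓝 t) (𝓝 (f t)) := by
    have : ContinuousAt (fun s => max 1 (s / t) * f t) t := by fun_prop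
    simpa [ContinuousAt, div_self ht.ne'] using this
  refine tendsto_of_tendsto_of_tendsto_of_le_of_le' hlo hhi ?_ ?_
  · filter_upwards [hpos] with s hs
    rcases le_total t s with h | h
    · rw [min_eq_left ((one_le_div ht).2 h), one_mul]
      exact hf.monotoneOn ht hs h
    · rw [min_eq_right ((div_le_one ht).2 h)]
      have := hf.map_mul_le ((one_le_div hs).2 h) hs
      rw [div_mul_cancel₀ _ hs.ne'] at this
      calc s / t * f t ≤ s / t * (t / s * f s) := by gcongr
        _ = f s := by field_simp
  · filter_upwards [hpos] with s hs
    rcases le_total t s with h | h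
    · rw [max_eq_right ((one_le_div ht).2 h)]
      have := hf.map_mul_le ((one_le_div ht).2 h) ht
      rwa [div_mul_cancel₀ _ ht.ne'] at this
    · rw [max_eq_left ((div_le_one ht).2 h), one_mul]
      exact hf.monotoneOn hs ht h

theorem mean_of_pos (f : ℝ → ℝ) {x y : ℝ} (hx : 0 < x) (hy : 0 < y) :
    mean f x y = y * f (x / y) := by
  simp [mean, hx.ne', hy.ne']

theorem IsFop.mean_nonneg (hf : IsFop f) (hreg : IsRegular f) {x y : ℝ} (hx : 0 ≤ x)
    (hy : 0 ≤ y) : 0 ≤ mean f x y := by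
  unfold mean
  split_ifs with h
  · exact mul_nonneg (by positivity) (le_of_lt hreg)
  · push Not at h
    have hx' : 0 < x := lt_of_le_of_ne hx h.1.symm
    have hy' : 0 < y := lt_of_le_of_ne hy h.2.symm
    exact mul_nonneg hy (hf.pos _ (by positivity)).le

theorem IsFop.eq_of_mean_eq_zero (hf : IsFop f) (hreg : IsRegular f) {x y : ℝ} (hx : 0 ≤ x)
    (hy : 0 ≤ y) (h : mean f x y = 0) : x = y := by
  unfold mean at h
  split_ifs at h with h'
  · have := (mul_eq_zero.1 h).resolve_right (ne_of_gt hreg)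
    linarith
  · push Not at h'
    have hx' : 0 < x := lt_of_le_of_ne hx h'.1.symm
    have hy' : 0 < y := lt_of_le_of_ne hy h'.2.symm
    exact absurd h (mul_pos hy' (hf.pos _ (by positivity))).ne'

theorem IsFop.mean_comm (hf : IsFop f) {x y : ℝ} (hx : 0 < x) (hy : 0 < y) :
    mean f x y = mean f y x := by
  rw [mean_of_pos f hx hy, mean_of_pos f hy hx, hf.symm _ (div_pos hx hy), inv_div]
  field_simp

/-- The boundary values of `mean f` are its limits along the diagonal direction. -/
theorem IsFop.tendsto_mean_add (hf : IsFop f) {x y c : ℝ} (hx : 0 ≤ x) (hy : 0 ≤ y) (hc : 0 < c) :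
    Tendsto (fun ε => mean f (x + c * ε) (y + c * ε)) (𝓝[>] 0) (𝓝 (mean f x y)) := by
  have hlin : ∀ z : ℝ, Tendsto (fun ε => z + c * ε) (𝓝[>] 0) (𝓝 z) := fun z => by
    have : ContinuousAt (fun ε : ℝ => z + c * ε) 0 := by fun_prop
    simpa [ContinuousAt] using this.tendsto.mono_left nhdsWithin_le_nhds
  have hzero : ∀ z : ℝ, 0 < z →
      Tendsto (fun ε => mean f (0 + c * ε) (z + c * ε)) (𝓝[>] 0) (𝓝 (z * zeroValue f)) := by
    intro z hz
    have h1 : Tendsto (fun ε => (0 + c * ε) / (z + c * ε)) (𝓝[>] 0) (𝓝[>] 0) := by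
      refine tendsto_nhdsWithin_iff.2 ⟨?_, ?_⟩
      · have := (hlin 0).div (hlin z) hz.ne'
        rwa [zero_div] at this
      · filter_upwards [self_mem_nhdsWithin] with ε hε
        have hε' : 0 < ε := hε
        exact Set.mem_Ioi.2 (by positivity)
    refine ((hlin z).mul (hf.tendsto_zeroValue.comp h1)).congr' ?_
    filter_upwards [self_mem_nhdsWithin] with ε hε
    have hε' : 0 < ε := hε
    rw [mean_of_pos f (by positivity) (by positivity)]
    rfl
  rcases hx.eq_or_lt with rfl | hx' <;> rcases hy.eq_or_lt with rfl | hy'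
  · have : mean f 0 0 = 0 := by simp [mean]
    rw [this]
    refine (hlin 0).congr' ?_
    filter_upwards [self_mem_nhdsWithin] with ε hε
    have hε' : 0 < ε := hε
    have hp : 0 < 0 + c * ε := by positivity
    rw [mean_of_pos f hp hp, div_self hp.ne', hf.map_one, mul_one]
  · simpa [mean] using hzero y hy'
  · have : mean f x 0 = x * zeroValue f := by simp [mean]
    rw [this]
    refine (hzero x hx').congr' ?_
    filter_upwards [self_mem_nhdsWithin] with ε hε
    have hε' : 0 < ε := hε
    exact hf.mean_comm (by positivity) (by positivity)
  · rw [mean_of_pos f hx' hy']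
    have h1 := (hf.continuousAt (div_pos hx' hy')).tendsto.comp ((hlin x).div (hlin y) hy'.ne')
    refine ((hlin y).mul h1).congr' ?_
    filter_upwards [self_mem_nhdsWithin] with ε hε
    have hε' : 0 < ε := hε
    rw [mean_of_pos f (by positivity) (by positivity)]
    rfl

end Scalar

/-! ### An operator Jensen inequality in coordinates -/

theorem star_dotProduct_diagonal_mulVec {α : Type*} [Fintype α] [DecidableEq α] (r : α → ℝ)
    (v : α → ℂ) :
    star v ⬝ᵥ (diagonal (fun a => (r a : ℂ)) *ᵥ v) = ((∑ a, r a * ‖v a‖ ^ 2 : ℝ) : ℂ) := by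
  simp only [dotProduct, mulVec_diagonal, Pi.star_apply]
  push_cast
  refine Finset.sum_congr rfl fun a _ => ?_
  rw [← Complex.conj_mul' (v a)]
  simp only [RCLike.star_def]
  ring

/-- Hansen's form of Jensen's inequality `W* f(X) W ≤ f(W* X W)` for an isometry `W`, where both
`X` and `W* X W` are diagonal. With `P = W W*` and `Q = 1 - P`, the matrix `X` is dominated by
`Y = (1 + δ²) P X P + (1 + δ⁻²) Q X Q`, whose functional calculus is block diagonal. -/
theorem IsFop.sum_map_mul_norm_sq_le {f : ℝ → ℝ} (hf : IsFop f) {N : ℕ} {β : Type*} [Fintype β]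
    [DecidableEq β] {d : Fin N → ℝ} (hd : ∀ i, 0 < d i) {e : β → ℝ} (he : ∀ b, 0 < e b)
    {W : Matrix (Fin N) β ℂ} (hW : Wᴴ * W = 1)
    (hWd : Wᴴ * diagonal (fun i => (d i : ℂ)) * W = diagonal (fun b => (e b : ℂ)))
    (v : β → ℂ) :
    ∑ i, f (d i) * ‖(W *ᵥ v) i‖ ^ 2 ≤ ∑ b, f (e b) * ‖v b‖ ^ 2 := by
  set X : Matrix (Fin N) (Fin N) ℂ := diagonal (fun i => (d i : ℂ)) with hX
  have hXpos : X.PosDef := PosDef.diagonal fun i => by simpa using hd i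
  have key : ∀ δ : ℝ, 0 < δ →
      ∑ i, f (d i) * ‖(W *ᵥ v) i‖ ^ 2 ≤ (1 + δ ^ 2) * ∑ b, f (e b) * ‖v b‖ ^ 2 := by
    intro δ hδ
    set P := W * Wᴴ with hP
    set Q := 1 - P with hQ
    have hPW : P * W = W := by rw [hP, Matrix.mul_assoc, hW, Matrix.mul_one]
    have hQW : Q * W = 0 := by rw [hQ, Matrix.sub_mul, hPW, Matrix.one_mul, sub_self]
    have hPh : Pᴴ = P := by simp [hP]
    have hQh : Qᴴ = Q := by simp [hQ, hPh]
    have hδ' : (δ : ℂ) * (δ : ℂ)⁻¹ = 1 := mul_inv_cancel₀ (by exact_mod_cast hδ.ne')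
    set D := (δ : ℂ) • P - (δ : ℂ)⁻¹ • Q with hD
    have hDh : Dᴴ = D := by
      simp [hD, conjTranspose_sub, conjTranspose_smul, hPh, hQh]
    -- expanding `X = (P + Q) X (P + Q)` shows that the mixed terms `P X Q`, `Q X P` cancel in `Y`
    set Y := X + Dᴴ * X * D with hY
    have hYpos : Y.PosDef :=
      hXpos.add_posSemidef (hXpos.posSemidef.conjTranspose_mul_mul_same D)
    have hDW : D * W = (δ : ℂ) • W := by
      rw [hD, Matrix.sub_mul, Matrix.smul_mul, Matrix.smul_mul, hPW, hQW, smul_zero, sub_zero]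
    have hYW : Y * W = W * diagonal (fun b => (((1 + δ ^ 2) * e b : ℝ) : ℂ)) := by
      have h1 : P * (X * W) = W * diagonal (fun b => (e b : ℂ)) := by
        rw [hP, Matrix.mul_assoc, ← hWd, Matrix.mul_assoc]
      have h2 : Q * (X * W) = X * W - P * (X * W) := by rw [hQ, Matrix.sub_mul, Matrix.one_mul]
      have h3 : diagonal (fun b => (((1 + δ ^ 2) * e b : ℝ) : ℂ)) =
          (1 + (δ : ℂ) ^ 2) • diagonal (fun b => (e b : ℂ)) := by
        ext a b
        by_cases hab : a = b <;> simp [hab]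
      rw [hY, hDh, Matrix.add_mul, Matrix.mul_assoc, Matrix.mul_assoc, hDW, Matrix.mul_smul,
        Matrix.mul_smul, hD, Matrix.sub_mul, Matrix.smul_mul, Matrix.smul_mul, h2, h1, h3,
        Matrix.mul_smul, smul_sub, smul_smul, smul_smul, hδ', add_smul, smul_sub]
      module
    have hmono := hf.operatorMonotone N X Y hXpos hYpos (by
      rw [hY, add_sub_cancel_left]
      exact hXpos.posSemidef.conjTranspose_mul_mul_same D)
    rw [hX, cfc_diagonal] at hmono
    have h := hmono.dotProduct_mulVec_nonneg (W *ᵥ v)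
    have hYv : cfc f Y *ᵥ (W *ᵥ v) =
        W *ᵥ (diagonal (fun b => (f ((1 + δ ^ 2) * e b) : ℂ)) *ᵥ v) := by
      rw [mulVec_mulVec, cfc_mul_of_mul_eq_mul_diagonal f hYpos.isHermitian hYW, mulVec_mulVec]
    rw [sub_mulVec, dotProduct_sub, star_dotProduct_diagonal_mulVec, hYv, star_mulVec,
      dotProduct_mulVec, vecMul_vecMul, hW, vecMul_one, star_dotProduct_diagonal_mulVec,
      ← Complex.ofReal_sub, ← Complex.ofReal_zero, Complex.real_le_real] at h
    refine (sub_nonneg.1 h).trans ?_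
    rw [Finset.mul_sum]
    refine Finset.sum_le_sum fun b _ => ?_
    rw [← mul_assoc]
    have := hf.map_mul_le (s := 1 + δ ^ 2) (by nlinarith [sq_nonneg δ]) (he b)
    gcongr
  have hlim : Tendsto (fun δ : ℝ => (1 + δ ^ 2) * ∑ b, f (e b) * ‖v b‖ ^ 2) (𝓝[>] 0)
      (𝓝 (∑ b, f (e b) * ‖v b‖ ^ 2)) := by
    have : ContinuousAt (fun δ : ℝ => (1 + δ ^ 2) * ∑ b, f (e b) * ‖v b‖ ^ 2) 0 := by fun_prop
    simpa [ContinuousAt] using this.tendsto.mono_left nhdsWithin_le_nhds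
  refine ge_of_tendsto hlim ?_
  filter_upwards [self_mem_nhdsWithin] with δ hδ using key δ hδ

/-- The transformer inequality `T* m(p,w) T ≤ m(T* p T, T* w T)` for the mean `m` of commuting
positive operators, in coordinates where all the operators are diagonal. It is Jensen's inequality
for the isometry `w^{1/2} T u^{-1/2}`. -/
theorem IsFop.sum_mean_mul_norm_sq_le {f : ℝ → ℝ} (hf : IsFop f) {α β : Type*} [Fintype α]
    [Fintype β] [DecidableEq β] {p w : α → ℝ} (hp : ∀ a, 0 < p a) (hw : ∀ a, 0 < w a)
    {q u : β → ℝ} (hq : ∀ b, 0 < q b) (hu : ∀ b, 0 < u b) {T : Matrix α β ℂ}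
    (hTp : ∀ b b', ∑ a, star (T a b) * T a b' * p a = if b = b' then (q b : ℂ) else 0)
    (hTw : ∀ b b', ∑ a, star (T a b) * T a b' * w a = if b = b' then (u b : ℂ) else 0)
    (v : β → ℂ) :
    ∑ a, mean f (p a) (w a) * ‖(T *ᵥ v) a‖ ^ 2 ≤ ∑ b, mean f (q b) (u b) * ‖v b‖ ^ 2 := by
  set E := Fintype.equivFin α with hE
  set W : Matrix (Fin (Fintype.card α)) β ℂ :=
    of fun i b => (√(w (E.symm i)) : ℂ) * T (E.symm i) b * (√(u b) : ℂ)⁻¹ with hWdef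
  have hsq : ∀ {r : ℝ}, 0 < r → (√r : ℂ) * (√r : ℂ) = r := fun {r} hr => by
    rw [← Complex.ofReal_mul, Real.mul_self_sqrt hr.le]
  have hne : ∀ {r : ℝ}, 0 < r → (√r : ℂ) ≠ 0 := fun {r} hr => by
    exact_mod_cast (Real.sqrt_pos.2 hr).ne'
  have hW : Wᴴ * W = 1 := by
    ext b b'
    have h := hTw b b'
    rw [← E.symm.sum_comp] at h
    have : (Wᴴ * W) b b' = (√(u b) : ℂ)⁻¹ * (√(u b') : ℂ)⁻¹ *
        ∑ i, star (T (E.symm i) b) * T (E.symm i) b' * w (E.symm i) := by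
      rw [mul_apply, Finset.mul_sum]
      refine Finset.sum_congr rfl fun i _ => ?_
      simp only [hWdef, conjTranspose_apply, of_apply, star_mul', RCLike.star_def, map_inv₀,
        Complex.conj_ofReal]
      rw [← hsq (hw (E.symm i))]
      ring
    rw [this, h, one_apply]
    split_ifs with hb
    · subst hb
      rw [← hsq (hu b)]
      have := hne (hu b)
      field_simp
    · simp
  have hWd : Wᴴ * diagonal (fun i => ((p (E.symm i) / w (E.symm i) : ℝ) : ℂ)) * W =
      diagonal (fun b => ((q b / u b : ℝ) : ℂ)) := by
    ext b b'
    have h := hTp b b'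
    rw [← E.symm.sum_comp] at h
    have : (Wᴴ * diagonal (fun i => ((p (E.symm i) / w (E.symm i) : ℝ) : ℂ)) * W) b b' =
        (√(u b) : ℂ)⁻¹ * (√(u b') : ℂ)⁻¹ *
        ∑ i, star (T (E.symm i) b) * T (E.symm i) b' * p (E.symm i) := by
      rw [mul_apply, Finset.mul_sum]
      refine Finset.sum_congr rfl fun i _ => ?_
      simp only [hWdef, mul_diagonal, conjTranspose_apply, of_apply, star_mul', RCLike.star_def,
        map_inv₀, Complex.conj_ofReal, Complex.ofReal_div]
      rw [← hsq (hw (E.symm i))]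
      have := hne (hw (E.symm i))
      field_simp
    rw [this, h, diagonal_apply]
    split_ifs with hb
    · subst hb
      rw [Complex.ofReal_div, ← hsq (hu b)]
      have := hne (hu b)
      field_simp
    · simp
  have h := hf.sum_map_mul_norm_sq_le (fun i => div_pos (hp (E.symm i)) (hw (E.symm i)))
    (fun b => div_pos (hq b) (hu b)) hW hWd (fun b => (√(u b) : ℂ) * v b)
  have hWv : ∀ i, (W *ᵥ fun b => (√(u b) : ℂ) * v b) i =
      (√(w (E.symm i)) : ℂ) * (T *ᵥ v) (E.symm i) := by
    intro i
    simp only [mulVec, dotProduct, Finset.mul_sum]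
    refine Finset.sum_congr rfl fun b _ => ?_
    have := hne (hu b)
    simp only [hWdef, of_apply]
    field_simp
  have hnorm : ∀ {r : ℝ} (z : ℂ), 0 < r → ‖(√r : ℂ) * z‖ ^ 2 = r * ‖z‖ ^ 2 := fun {r} z hr => by
    rw [norm_mul, mul_pow, Complex.norm_real, Real.norm_of_nonneg (Real.sqrt_nonneg r),
      Real.sq_sqrt hr.le]
  rw [← E.symm.sum_comp]
  convert h using 1
  · refine Finset.sum_congr rfl fun i _ => ?_
    rw [hWv, hnorm _ (hw _), mean_of_pos f (hp _) (hw _)]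
    ring
  · refine Finset.sum_congr rfl fun b _ => ?_
    rw [hnorm _ (hu b), mean_of_pos f (hq b) (hu b)]
    ring

/-! ### Monotonicity of the skew information under restriction to a subsystem -/

theorem trace_conjTranspose_mul_mul_diagonal {α : Type*} [Fintype α] [DecidableEq α]
    (A B : Matrix α α ℂ) (r : α → ℂ) :
    (Aᴴ * B * diagonal r).trace = ∑ x : α × α, star (A x.1 x.2) * B x.1 x.2 * r x.2 := by
  simp only [trace, diag_apply, mul_diagonal]
  simp only [mul_apply, conjTranspose_apply, Finset.sum_mul]
  rw [Fintype.sum_prod_type_right]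

theorem trace_mul_conjTranspose_mul_diagonal {α : Type*} [Fintype α] [DecidableEq α]
    (A B : Matrix α α ℂ) (r : α → ℂ) :
    (B * Aᴴ * diagonal r).trace = ∑ x : α × α, star (A x.1 x.2) * B x.1 x.2 * r x.1 := by
  simp only [trace, diag_apply, mul_diagonal]
  simp only [mul_apply, conjTranspose_apply, Finset.sum_mul]
  rw [Fintype.sum_prod_type]
  refine Finset.sum_congr rfl fun i _ => Finset.sum_congr rfl fun j _ => by ring

theorem sum_single_mul_single {m : Type*} [Fintype m] [DecidableEq m] (y y' : m × m)
    (r : m × m → ℂ) :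
    ∑ x : m × m, star (single y.1 y.2 (1 : ℂ) x.1 x.2) * single y'.1 y'.2 1 x.1 x.2 * r x =
      if y = y' then r y else 0 := by
  rw [Finset.sum_eq_single y]
  · by_cases hy : y = y'
    · subst hy; simp
    · have : ¬ (y'.1 = y.1 ∧ y'.2 = y.2) := fun h => hy (Prod.ext h.1.symm h.2.symm)
      simp [hy, this]
  · intro x _ hx
    have : ¬ (y.1 = x.1 ∧ y.2 = x.2) := fun h => hx (Prod.ext h.1.symm h.2.symm)
    simp [this]
  · simp

theorem diagonal_ofReal_add {α : Type*} [DecidableEq α] (r : α → ℝ) (s : ℝ) :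
    diagonal (fun a => ((r a + s : ℝ) : ℂ)) =
      diagonal (fun a => (r a : ℂ)) + (s : ℂ) • (1 : Matrix α α ℂ) := by
  ext a b
  by_cases hab : a = b <;> simp [hab]

section Restriction

variable {m p : Type*} [Fintype m] [DecidableEq m] [Fintype p] [DecidableEq p]
  {f : ℝ → ℝ} (Ψ : Matrix m m ℂ →⋆ₐ[ℂ] Matrix p p ℂ) {lam : p → ℝ} {mu : m → ℝ}

/-- Petz's inequality `Ψ* m(L_ρ,R_ρ) Ψ ≤ m(L_σ,R_σ)` when `σ` is the restriction of `ρ` along `Ψ`,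
for `ρ` and `σ` diagonal and positive definite. -/
theorem IsFop.petz_of_pos (hf : IsFop f) (hlam : ∀ k, 0 < lam k) (hmu : ∀ a, 0 < mu a)
    (h : ∀ z, (Ψ z * diagonal (fun k => (lam k : ℂ))).trace =
      (z * diagonal (fun a => (mu a : ℂ))).trace) (z : Matrix m m ℂ) :
    ∑ x : p × p, mean f (lam x.1) (lam x.2) * ‖Ψ z x.1 x.2‖ ^ 2 ≤
      ∑ x : m × m, mean f (mu x.1) (mu x.2) * ‖z x.1 x.2‖ ^ 2 := by
  set T : Matrix (p × p) (m × m) ℂ := of fun x y => Ψ (single y.1 y.2 1) x.1 x.2 with hT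
  have hTz : ∀ x, (T *ᵥ fun y => z y.1 y.2) x = Ψ z x.1 x.2 := by
    intro x
    conv_rhs => rw [matrix_eq_sum_single z]
    simp only [map_sum, Matrix.sum_apply, mulVec, dotProduct, Fintype.sum_prod_type]
    refine Finset.sum_congr rfl fun a _ => Finset.sum_congr rfl fun b _ => ?_
    have : single a b (z a b) = z a b • single a b (1 : ℂ) := by simp
    rw [this, map_smul, hT, of_apply, Matrix.smul_apply, smul_eq_mul, mul_comm]
  have hstar : ∀ y : m × m, (Ψ (single y.1 y.2 1))ᴴ = Ψ (single y.2 y.1 1) := fun y => by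
    rw [← star_eq_conjTranspose, ← map_star, star_eq_conjTranspose, conjTranspose_single, star_one]
  have := hf.sum_mean_mul_norm_sq_le (p := fun x : p × p => lam x.1) (w := fun x : p × p => lam x.2)
    (q := fun y : m × m => mu y.1) (u := fun y : m × m => mu y.2) (fun _ => hlam _)
    (fun _ => hlam _) (fun _ => hmu _) (fun _ => hmu _) (T := T) ?_ ?_ (fun y => z y.1 y.2)
  · simpa only [hTz] using this
  · intro y y'
    have h1 := trace_mul_conjTranspose_mul_diagonal (Ψ (single y.1 y.2 1)) (Ψ (single y'.1 y'.2 1))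
      (fun k => (lam k : ℂ))
    rw [hstar, ← map_mul, h] at h1
    refine h1.symm.trans ?_
    have h2 := trace_mul_conjTranspose_mul_diagonal (single y.1 y.2 (1 : ℂ)) (single y'.1 y'.2 1)
      (fun k => (mu k : ℂ))
    rw [conjTranspose_single, star_one] at h2
    rw [h2, sum_single_mul_single]
  · intro y y'
    have h1 := trace_conjTranspose_mul_mul_diagonal (Ψ (single y.1 y.2 1)) (Ψ (single y'.1 y'.2 1))
      (fun k => (lam k : ℂ))
    rw [hstar, ← map_mul, h] at h1
    refine h1.symm.trans ?_
    have h2 := trace_conjTranspose_mul_mul_diagonal (single y.1 y.2 (1 : ℂ)) (single y'.1 y'.2 1)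
      (fun k => (mu k : ℂ))
    rw [conjTranspose_single, star_one] at h2
    rw [h2, sum_single_mul_single]

/-- Petz's inequality for diagonal positive semidefinite matrices, by the perturbation
`ρ + ε 1`, which restricts to `σ + c ε 1`. -/
theorem IsFop.petz (hf : IsFop f) (hlam : ∀ k, 0 ≤ lam k) (hmu : ∀ a, 0 ≤ mu a)
    (h : ∀ z, (Ψ z * diagonal (fun k => (lam k : ℂ))).trace =
      (z * diagonal (fun a => (mu a : ℂ))).trace)
    {c : ℝ} (hc : 0 < c) (hΨ : ∀ z, (Ψ z).trace = c * z.trace) (z : Matrix m m ℂ) :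
    ∑ x : p × p, mean f (lam x.1) (lam x.2) * ‖Ψ z x.1 x.2‖ ^ 2 ≤
      ∑ x : m × m, mean f (mu x.1) (mu x.2) * ‖z x.1 x.2‖ ^ 2 := by
  have hl : Tendsto (fun ε : ℝ => ∑ x : p × p, mean f (lam x.1 + 1 * ε) (lam x.2 + 1 * ε) *
      ‖Ψ z x.1 x.2‖ ^ 2) (𝓝[>] 0)
      (𝓝 (∑ x : p × p, mean f (lam x.1) (lam x.2) * ‖Ψ z x.1 x.2‖ ^ 2)) :=
    tendsto_finsetSum _ fun x _ => (hf.tendsto_mean_add (hlam _) (hlam _) one_pos).mul_const _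
  have hr : Tendsto (fun ε : ℝ => ∑ x : m × m, mean f (mu x.1 + c * ε) (mu x.2 + c * ε) *
      ‖z x.1 x.2‖ ^ 2) (𝓝[>] 0)
      (𝓝 (∑ x : m × m, mean f (mu x.1) (mu x.2) * ‖z x.1 x.2‖ ^ 2)) :=
    tendsto_finsetSum _ fun x _ => (hf.tendsto_mean_add (hmu _) (hmu _) hc).mul_const _
  refine le_of_tendsto_of_tendsto hl hr ?_
  filter_upwards [self_mem_nhdsWithin] with ε hε
  have hε' : 0 < ε := hε
  refine hf.petz_of_pos Ψ (lam := fun k => lam k + 1 * ε) (mu := fun a => mu a + c * ε)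
    (fun k => add_pos_of_nonneg_of_pos (hlam k) (by positivity))
    (fun a => add_pos_of_nonneg_of_pos (hmu a) (by positivity)) (fun w => ?_) z
  rw [diagonal_ofReal_add, diagonal_ofReal_add, Matrix.mul_add, Matrix.mul_add, trace_add,
    trace_add, h, Matrix.mul_smul, Matrix.mul_smul, trace_smul, trace_smul, Matrix.mul_one,
    Matrix.mul_one, hΨ]
  simp only [smul_eq_mul]
  push_cast
  ring

end Restriction

theorem trace_conjTranspose_mul_commutator {α : Type*} [Fintype α] [DecidableEq α]
    (A B : Matrix α α ℂ) (r : α → ℝ) :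
    ((B * Aᴴ - Aᴴ * B) * diagonal (fun a => (r a : ℂ))).trace =
      ∑ x : α × α, star (A x.1 x.2) * B x.1 x.2 * ((r x.1 - r x.2 : ℝ) : ℂ) := by
  rw [Matrix.sub_mul, trace_sub, trace_mul_conjTranspose_mul_diagonal,
    trace_conjTranspose_mul_mul_diagonal, ← Finset.sum_sub_distrib]
  refine Finset.sum_congr rfl fun x _ => ?_
  push_cast
  ring

section Restriction

variable {m p : Type*} [Fintype m] [DecidableEq m] [Fintype p] [DecidableEq p]
  {f : ℝ → ℝ} (Ψ : Matrix m m ℂ →⋆ₐ[ℂ] Matrix p p ℂ) {lam : p → ℝ} {mu : m → ℝ}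

/-- Monotonicity of the skew information in coordinates where `ρ` and its restriction `σ` are
diagonal. It is dual to Petz's inequality: `‖x‖²/m` is the supremum over `z` of
`2 Re (z̄ x) - m ‖z‖²`, and the trial vector is the optimal one for `σ`. -/
theorem IsFop.sum_inv_mean_le (hf : IsFop f) (hreg : IsRegular f) (hlam : ∀ k, 0 ≤ lam k)
    (hmu : ∀ a, 0 ≤ mu a)
    (h : ∀ z, (Ψ z * diagonal (fun k => (lam k : ℂ))).trace =
      (z * diagonal (fun a => (mu a : ℂ))).trace)
    {c : ℝ} (hc : 0 < c) (hΨ : ∀ z, (Ψ z).trace = c * z.trace) (A : Matrix m m ℂ) :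
    ∑ x : m × m, (mean f (mu x.1) (mu x.2))⁻¹ * ((mu x.1 - mu x.2) ^ 2 * ‖A x.1 x.2‖ ^ 2) ≤
      ∑ x : p × p, (mean f (lam x.1) (lam x.2))⁻¹ *
        ((lam x.1 - lam x.2) ^ 2 * ‖Ψ A x.1 x.2‖ ^ 2) := by
  set z : Matrix m m ℂ := of fun a b =>
    (((mean f (mu a) (mu b))⁻¹ * (mu a - mu b) : ℝ) : ℂ) * A a b with hz
  set S := ∑ x : m × m,
    (mean f (mu x.1) (mu x.2))⁻¹ * ((mu x.1 - mu x.2) ^ 2 * ‖A x.1 x.2‖ ^ 2) with hS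
  have hpair : (S : ℂ) =
      ∑ x : p × p, star (Ψ z x.1 x.2) * Ψ A x.1 x.2 * ((lam x.1 - lam x.2 : ℝ) : ℂ) := by
    rw [← trace_conjTranspose_mul_commutator, ← star_eq_conjTranspose, ← map_star, ← map_mul,
      ← map_mul, ← map_sub, h, star_eq_conjTranspose, trace_conjTranspose_mul_commutator, hS]
    push_cast
    refine Finset.sum_congr rfl fun x _ => ?_
    simp only [hz, of_apply, star_mul', RCLike.star_def, Complex.conj_ofReal]
    rw [← Complex.conj_mul']
    push_cast
    ring
  have hquad : S = ∑ x : m × m, mean f (mu x.1) (mu x.2) * ‖z x.1 x.2‖ ^ 2 := by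
    refine Finset.sum_congr rfl fun x _ => ?_
    rw [hz, of_apply, norm_mul, Complex.norm_real, mul_pow, Real.norm_eq_abs, sq_abs]
    -- also true when the mean is `0`, since then both sides vanish
    by_cases h0 : mean f (mu x.1) (mu x.2) = 0
    · simp [h0]
    · field_simp
  have hpetz := hf.petz Ψ hlam hmu h hc hΨ z
  have hre := congrArg Complex.re hpair
  rw [Complex.ofReal_re, Complex.re_sum] at hre
  have hpoint : ∀ x : p × p,
      2 * (star (Ψ z x.1 x.2) * Ψ A x.1 x.2 * ((lam x.1 - lam x.2 : ℝ) : ℂ)).re -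
        mean f (lam x.1) (lam x.2) * ‖Ψ z x.1 x.2‖ ^ 2 ≤
      (mean f (lam x.1) (lam x.2))⁻¹ * ((lam x.1 - lam x.2) ^ 2 * ‖Ψ A x.1 x.2‖ ^ 2) := by
    intro x
    set M := mean f (lam x.1) (lam x.2) with hM
    set y := Ψ z x.1 x.2
    set a := Ψ A x.1 x.2
    set t := lam x.1 - lam x.2 with ht
    have hM0 : 0 ≤ M := hf.mean_nonneg hreg (hlam _) (hlam _)
    rcases hM0.eq_or_lt with h0 | h0
    · have : t = 0 := sub_eq_zero.2 (hf.eq_of_mean_eq_zero hreg (hlam _) (hlam _) h0.symm)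
      simp [← h0, this]
    · have h1 : (star y * a * (t : ℂ)).re ≤ ‖y‖ * (|t| * ‖a‖) := by
        refine (Complex.re_le_norm _).trans_eq ?_
        rw [norm_mul, norm_mul, norm_star, Complex.norm_real, Real.norm_eq_abs]
        ring
      have h2 : M⁻¹ * (t ^ 2 * ‖a‖ ^ 2) - (2 * (‖y‖ * (|t| * ‖a‖)) - M * ‖y‖ ^ 2) =
          M⁻¹ * (|t| * ‖a‖ - M * ‖y‖) ^ 2 := by
        rw [← sq_abs t]
        field_simp
        ring
      have h3 : 0 ≤ M⁻¹ * (|t| * ‖a‖ - M * ‖y‖) ^ 2 := by positivity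
      linarith
  have hsum := Finset.sum_le_sum fun x (_ : x ∈ Finset.univ) => hpoint x
  rw [Finset.sum_sub_distrib, ← Finset.mul_sum, ← hre] at hsum
  linarith

end Restriction

/-! ### Coordinates in the eigenbasis of a state -/

section Coordinates

variable {p : Type*} [Fintype p] [DecidableEq p]

/-- The `*`-automorphism that passes to coordinates in the eigenbasis of `ρ`. -/
noncomputable def State.coords (ρ : State p) : Matrix p p ℂ ≃⋆ₐ[ℂ] Matrix p p ℂ :=
  conjStarAlgAut ℂ _ (star ρ.posSemidef.isHermitian.eigenvectorUnitary)

/-- The eigenvalues of `ρ`, listed in the order of the eigenbasis used by `State.coords`. -/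
noncomputable def State.eigenvalues (ρ : State p) : p → ℝ :=
  ρ.posSemidef.isHermitian.eigenvalues

theorem State.eigenvalues_nonneg (ρ : State p) (k : p) : 0 ≤ ρ.eigenvalues k :=
  ρ.posSemidef.eigenvalues_nonneg k

theorem State.coords_toMatrix (ρ : State p) :
    ρ.coords ρ.toMatrix = diagonal (fun k => (ρ.eigenvalues k : ℂ)) :=
  ρ.posSemidef.isHermitian.conjStarAlgAut_star_eigenvectorUnitary

theorem State.trace_coords (ρ : State p) (X : Matrix p p ℂ) : (ρ.coords X).trace = X.trace := by
  rw [State.coords, conjStarAlgAut_star_apply, trace_mul_comm, ← Matrix.mul_assoc,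
    Unitary.mul_star_self_of_mem (SetLike.coe_mem _), Matrix.one_mul]

theorem skewInformation_eq_sum (f : ℝ → ℝ) (ρ : State p) (A : Matrix p p ℂ) :
    skewInformation f ρ A = zeroValue f / 2 * ∑ x : p × p,
      (mean f (ρ.eigenvalues x.1) (ρ.eigenvalues x.2))⁻¹ *
        ((ρ.eigenvalues x.1 - ρ.eigenvalues x.2) ^ 2 * ‖ρ.coords A x.1 x.2‖ ^ 2) := by
  unfold skewInformation
  congr 1
  set X := Complex.I • (ρ.toMatrix * A - A * ρ.toMatrix) with hX
  set U := ρ.posSemidef.isHermitian.eigenvectorUnitary with hU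
  have hc : ∀ Y, ρ.coords Y = (U : Matrix p p ℂ)ᴴ * Y * U := fun Y => by
    rw [State.coords, conjStarAlgAut_star_apply]; rfl
  have hXc : ∀ k l, ρ.coords X k l =
      Complex.I * (((ρ.eigenvalues k - ρ.eigenvalues l : ℝ) : ℂ) * ρ.coords A k l) := by
    intro k l
    rw [hX, map_smul, map_sub, map_mul, map_mul, ρ.coords_toMatrix, Matrix.smul_apply,
      Matrix.sub_apply, diagonal_mul, mul_diagonal]
    push_cast
    simp only [smul_eq_mul]
    ring
  have htr : monotoneMetric (morozovaChentsovExt f) ρ.posSemidef.isHermitian X X =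
      ((∑ x : p × p, (mean f (ρ.eigenvalues x.1) (ρ.eigenvalues x.2))⁻¹ *
        ((ρ.eigenvalues x.1 - ρ.eigenvalues x.2) ^ 2 * ‖ρ.coords A x.1 x.2‖ ^ 2) : ℝ) : ℂ) := by
    have h1 : monotoneMetric (morozovaChentsovExt f) ρ.posSemidef.isHermitian X X =
        ((ρ.coords X)ᴴ * of fun k l => ((mean f (ρ.eigenvalues k) (ρ.eigenvalues l))⁻¹ : ℂ) *
          ρ.coords X k l).trace := by
      have h2 : (of fun k l => ((mean f (ρ.eigenvalues k) (ρ.eigenvalues l))⁻¹ : ℂ) *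
          ρ.coords X k l) = (of fun i j =>
            (morozovaChentsovExt f (ρ.posSemidef.isHermitian.eigenvalues i)
              (ρ.posSemidef.isHermitian.eigenvalues j) : ℂ)) ⊙ ((U : Matrix p p ℂ)ᴴ * X * U) := by
        ext k l
        simp only [of_apply, hadamard_apply, morozovaChentsovExt_eq_inv_mean, ← hc,
          Complex.ofReal_inv, State.eigenvalues]
      rw [h2, hc X, conjTranspose_mul, conjTranspose_mul, conjTranspose_conjTranspose,
        Matrix.mul_assoc (U : Matrix p p ℂ)ᴴ, Matrix.mul_assoc (U : Matrix p p ℂ)ᴴ,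
        trace_mul_comm (U : Matrix p p ℂ)ᴴ]
      simp only [monotoneMetric, leftRightCalculus, ← hU, Matrix.mul_assoc]
    have h3 := trace_conjTranspose_mul_mul_diagonal (ρ.coords X)
      (of fun k l => ((mean f (ρ.eigenvalues k) (ρ.eigenvalues l))⁻¹ : ℂ) * ρ.coords X k l) 1
    rw [Pi.one_def, diagonal_one, Matrix.mul_one] at h3
    rw [h1, h3]
    push_cast
    refine Finset.sum_congr rfl fun x _ => ?_
    simp only [of_apply, hXc, star_mul', RCLike.star_def, Complex.conj_I, Complex.conj_ofReal]
    rw [← Complex.conj_mul']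
    push_cast
    linear_combination (-(starRingEnd ℂ (ρ.coords A x.1 x.2)) * (ρ.coords A x.1 x.2) *
      (mean f (ρ.eigenvalues x.1) (ρ.eigenvalues x.2) : ℂ)⁻¹ *
      ((ρ.eigenvalues x.1 : ℂ) - ρ.eigenvalues x.2) ^ 2) * Complex.I_mul_I
  rw [htr, Complex.ofReal_re]

/-- The skew information does not increase under restriction of the state along a unital
`*`-homomorphism `Φ` of matrix algebras. The hypothesis on traces holds for every such `Φ`; it
says that the unnormalised trace restricts to a multiple of the trace. -/
theorem skewInformation_le_of_restriction {m : Type*} [Fintype m] [DecidableEq m] {f : ℝ → ℝ}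
    (hf : IsFop f) (hreg : IsRegular f) (Φ : Matrix m m ℂ →⋆ₐ[ℂ] Matrix p p ℂ) {ρ : State p}
    {σ : State m} (h : ∀ z, (Φ z * ρ.toMatrix).trace = (z * σ.toMatrix).trace)
    {c : ℝ} (hc : 0 < c) (hΦ : ∀ z, (Φ z).trace = c * z.trace) (A : Matrix m m ℂ) :
    skewInformation f σ A ≤ skewInformation f ρ (Φ A) := by
  have hsymm : ∀ X, (σ.coords.symm X).trace = X.trace := fun X => by
    rw [← σ.trace_coords, StarAlgEquiv.apply_symm_apply]
  set Ψ : Matrix m m ℂ →⋆ₐ[ℂ] Matrix p p ℂ :=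
    (ρ.coords : Matrix p p ℂ →⋆ₐ[ℂ] Matrix p p ℂ).comp
      (Φ.comp (σ.coords.symm : Matrix m m ℂ →⋆ₐ[ℂ] Matrix m m ℂ)) with hΨ
  have hΨa : ∀ X, Ψ X = ρ.coords (Φ (σ.coords.symm X)) := fun X => rfl
  have key := hf.sum_inv_mean_le Ψ hreg ρ.eigenvalues_nonneg σ.eigenvalues_nonneg
    (fun z => by
      rw [hΨa, ← ρ.coords_toMatrix, ← map_mul, ρ.trace_coords, h, ← σ.coords_toMatrix,
        ← σ.trace_coords, map_mul, StarAlgEquiv.apply_symm_apply]) hc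
    (fun z => by rw [hΨa, ρ.trace_coords, hΦ, hsymm]) (σ.coords A)
  rw [hΨa, StarAlgEquiv.symm_apply_apply] at key
  rw [skewInformation_eq_sum, skewInformation_eq_sum]
  exact mul_le_mul_of_nonneg_left key (div_nonneg (le_of_lt hreg) zero_le_two)

end Coordinates

/-! ### Local measurements -/

section Measurement

variable {m : Type*} [Fintype m] [DecidableEq m]

/-- Projections with sum `1` are mutually orthogonal: `∑_{i ≠ j} P_j P_i P_j = 0` is a sum of
positive matrices. -/
theorem IsVonNeumannMeasurement.mul_eq_zero {ι : Type*} [Fintype ι] [DecidableEq ι]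
    {P : ι → Matrix m m ℂ} (hP : IsVonNeumannMeasurement P) {i j : ι} (hij : i ≠ j) :
    P i * P j = 0 := by
  have hsq : ∀ k, P k * P k = P k := fun k => (hP.isStarProjection k).isIdempotentElem
  have hstar : ∀ k, (P k)ᴴ = P k := fun k => (hP.isStarProjection k).isSelfAdjoint
  have hexp : ∀ k, (P k * P j)ᴴ * (P k * P j) = P j * P k * P j := fun k => by
    rw [conjTranspose_mul, hstar, hstar, Matrix.mul_assoc, ← Matrix.mul_assoc (P k), hsq,
      ← Matrix.mul_assoc]
  have hsum : ∑ k, P j * P k * P j = P j := by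
    rw [← Finset.sum_mul, ← Finset.mul_sum, hP.sum_eq_one, Matrix.mul_one, hsq]
  rw [← Finset.add_sum_erase _ _ (Finset.mem_univ j), hsq, hsq, add_eq_left] at hsum
  have htr := congrArg trace hsum
  rw [trace_sum, trace_zero, Finset.sum_eq_zero_iff_of_nonneg] at htr
  · have := htr i (Finset.mem_erase.2 ⟨hij, Finset.mem_univ i⟩)
    rwa [← hexp, trace_conjTranspose_mul_self_eq_zero_iff] at this
  · intro k _
    rw [← hexp]
    exact (posSemidef_conjTranspose_mul_self _).trace_nonneg

theorem exists_mul_mul_eq_smul_of_rank_eq_one {P : Matrix m m ℂ} (hP : P.rank = 1)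
    (A : Matrix m m ℂ) : ∃ a : ℂ, P * A * P = a • P := by
  obtain ⟨v, -, hv⟩ := finrank_eq_one_iff'.1 hP
  have hcol : ∀ j, ∃ c : ℂ, ∀ i, P i j = c * (v : m → ℂ) i := fun j => by
    obtain ⟨c, hc⟩ := hv ⟨P *ᵥ Pi.single j 1, Pi.single j 1, rfl⟩
    refine ⟨c, fun i => ?_⟩
    have := congrFun (congrArg Subtype.val hc) i
    simpa using this.symm
  choose c hc using hcol
  have hvec : P = vecMulVec v c := by
    ext i j
    rw [hc, vecMulVec_apply, mul_comm]
  generalize (v : m → ℂ) = u at hvec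
  refine ⟨c ⬝ᵥ (A *ᵥ u), ?_⟩
  rw [hvec, Matrix.mul_assoc, mul_vecMulVec, vecMulVec_mul_vecMulVec]
  ext i j
  simp only [vecMulVec_apply, Matrix.smul_apply, Pi.smul_apply, smul_eq_mul]
  ring

end Measurement

section Additivity

variable {p : Type*} [Fintype p] [DecidableEq p]

theorem apply_eq_of_commute_diagonal {R : Matrix p p ℂ} {lam : p → ℝ}
    (h : Commute R (diagonal fun k => (lam k : ℂ))) {k l : p} (hkl : R k l ≠ 0) :
    lam k = lam l := by
  have := congrFun (congrFun h.eq k) l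
  rw [mul_diagonal, diagonal_mul, mul_comm] at this
  exact (Complex.ofReal_injective (mul_right_cancel₀ hkl this)).symm

/-- Schur multiplication by a function of the eigenvalues is a bimodule map over the commutant of
the diagonal matrix of eigenvalues. -/
theorem mul_hadamard_mul_of_commute_diagonal {R S : Matrix p p ℂ} {lam : p → ℝ}
    (hR : Commute R (diagonal fun k => (lam k : ℂ)))
    (hS : Commute S (diagonal fun k => (lam k : ℂ)))
    (w : ℝ → ℝ → ℂ) (X : Matrix p p ℂ) :
    R * (of (fun k l => w (lam k) (lam l)) ⊙ X) * S =
      of (fun k l => w (lam k) (lam l)) ⊙ (R * X * S) := by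
  ext k l
  simp only [mul_apply, hadamard_apply, of_apply, Finset.sum_mul, Finset.mul_sum]
  refine Finset.sum_congr rfl fun j _ => Finset.sum_congr rfl fun i _ => ?_
  by_cases hRi : R k i = 0
  · simp [hRi]
  by_cases hSj : S j l = 0
  · simp [hSj]
  rw [apply_eq_of_commute_diagonal hR hRi, apply_eq_of_commute_diagonal hS hSj]
  ring

/-- If `ρ` is block diagonal for the projections `R i`, then the skew information is additive on a
sum `X + Y` where `Y` is block diagonal and the diagonal blocks of `X` are scalar: the commutator
`[ρ, Y]` is block diagonal, the commutator `[ρ, X]` is off-diagonal, and the metric preserves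
blocks. -/
theorem skewInformation_add_of_pinching (f : ℝ → ℝ) (ρ : State p) {ι : Type*} [Fintype ι]
    {R : ι → Matrix p p ℂ} (hRR : ∀ i, R i * R i = R i) (hsum : ∑ i, R i = 1)
    (hρ : ∀ i, Commute (R i) ρ.toMatrix) {X Y : Matrix p p ℂ}
    (hX : ∀ i, ∃ a : ℂ, R i * X * R i = a • R i) (hY : ∀ i, Commute (R i) Yᴴ) :
    skewInformation f ρ (X + Y) = skewInformation f ρ X + skewInformation f ρ Y := by
  set w : ℝ → ℝ → ℝ := fun s t => (mean f s t)⁻¹ * (s - t) ^ 2 with hw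
  set Z : Matrix p p ℂ :=
    of (fun k l => (w (ρ.eigenvalues k) (ρ.eigenvalues l) : ℂ)) ⊙ ρ.coords X with hZ
  set R' : ι → Matrix p p ℂ := fun i => ρ.coords (R i) with hR'
  have hcomm : ∀ i, Commute (R' i) (diagonal fun k => (ρ.eigenvalues k : ℂ)) := fun i => by
    rw [← ρ.coords_toMatrix]
    exact (hρ i).map ρ.coords
  have hblock : ∀ i, R' i * Z * R' i = 0 := by
    intro i
    obtain ⟨a, ha⟩ := hX i
    rw [hZ, mul_hadamard_mul_of_commute_diagonal (hcomm i) (hcomm i) (fun s t => (w s t : ℂ)),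
      hR', ← map_mul, ← map_mul, ha]
    ext k l
    rw [hadamard_apply, of_apply, map_smul, Matrix.smul_apply]
    by_cases h0 : R' i k l = 0
    · rw [show ρ.coords (R i) k l = 0 from h0, smul_zero, mul_zero, Matrix.zero_apply]
    · simp [hw, apply_eq_of_commute_diagonal (hcomm i) h0]
  have hcross : ((ρ.coords Y)ᴴ * Z).trace = 0 := by
    have hYc : ∀ i, Commute (R' i) (ρ.coords Y)ᴴ := fun i => by
      rw [← star_eq_conjTranspose, ← map_star]
      exact (hY i).map ρ.coords
    have hsq : ∀ i, R' i * R' i = R' i := fun i => by rw [hR', ← map_mul, hRR]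
    have h1 : ∑ i, R' i = 1 := by rw [hR', ← map_sum, hsum, map_one]
    rw [← Matrix.one_mul ((ρ.coords Y)ᴴ * Z), ← h1, Finset.sum_mul, trace_sum]
    refine Finset.sum_eq_zero fun i _ => ?_
    rw [← hsq i, Matrix.mul_assoc, trace_mul_comm, ← Matrix.mul_assoc (R' i), (hYc i).eq,
      Matrix.mul_assoc, Matrix.mul_assoc, ← Matrix.mul_assoc (R' i), hblock, Matrix.mul_zero,
      trace_zero]
  have hcross' : ∑ x : p × p, w (ρ.eigenvalues x.1) (ρ.eigenvalues x.2) *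
      (star (ρ.coords Y x.1 x.2) * ρ.coords X x.1 x.2).re = 0 := by
    have h3 := trace_conjTranspose_mul_mul_diagonal (ρ.coords Y) Z 1
    rw [Pi.one_def, diagonal_one, Matrix.mul_one, hcross] at h3
    have h4 := congrArg Complex.re h3
    rw [Complex.zero_re, Complex.re_sum] at h4
    rw [h4]
    refine Finset.sum_congr rfl fun x _ => ?_
    rw [← Complex.re_ofReal_mul]
    congr 1
    simp only [hZ, hadamard_apply, of_apply]
    ring
  have hexp : ∀ x y : ℂ, ‖x + y‖ ^ 2 = ‖x‖ ^ 2 + ‖y‖ ^ 2 + 2 * (star y * x).re := by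
    intro x y
    simp only [Complex.sq_norm, Complex.normSq_apply, RCLike.star_def, Complex.mul_re,
      Complex.add_re, Complex.add_im, Complex.conj_re, Complex.conj_im]
    ring
  rw [skewInformation_eq_sum, skewInformation_eq_sum, skewInformation_eq_sum, ← mul_add,
    ← Finset.sum_add_distrib]
  congr 1
  rw [← sub_eq_zero, ← Finset.sum_sub_distrib, ← mul_zero 2, ← hcross', Finset.mul_sum]
  refine Finset.sum_congr rfl fun x _ => ?_
  rw [map_add, Matrix.add_apply, hexp]
  ring

end Additivity

/-! ### Bipartite systems -/

section BipartiteSystem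

variable {m n : Type*} [Fintype m] [DecidableEq m] [Fintype n] [DecidableEq n]

/-- The embedding `A ↦ A ⊗ 1` of the observables of the first party. -/
def embed₁ (m n : Type*) [Fintype m] [DecidableEq m] [Fintype n] [DecidableEq n] :
    Matrix m m ℂ →⋆ₐ[ℂ] Matrix (m × n) (m × n) ℂ where
  toFun A := A ⊗ₖ (1 : Matrix n n ℂ)
  map_one' := one_kronecker_one
  map_mul' A A' := by rw [← mul_kronecker_mul, Matrix.mul_one]
  map_zero' := zero_kronecker _
  map_add' A A' := add_kronecker A A' _
  commutes' r := by
    rw [Algebra.algebraMap_eq_smul_one, smul_kronecker, one_kronecker_one,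
      Algebra.algebraMap_eq_smul_one]
  map_star' A := by simp [star_eq_conjTranspose, conjTranspose_kronecker]

/-- The embedding `B ↦ 1 ⊗ B` of the observables of the second party. -/
def embed₂ (m n : Type*) [Fintype m] [DecidableEq m] [Fintype n] [DecidableEq n] :
    Matrix n n ℂ →⋆ₐ[ℂ] Matrix (m × n) (m × n) ℂ where
  toFun B := (1 : Matrix m m ℂ) ⊗ₖ B
  map_one' := one_kronecker_one
  map_mul' B B' := by rw [← mul_kronecker_mul, Matrix.mul_one]
  map_zero' := kronecker_zero _
  map_add' B B' := kronecker_add _ B B'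
  commutes' r := by
    rw [Algebra.algebraMap_eq_smul_one, kronecker_smul, one_kronecker_one,
      Algebra.algebraMap_eq_smul_one]
  map_star' B := by simp [star_eq_conjTranspose, conjTranspose_kronecker]

theorem embed₁_apply (A : Matrix m m ℂ) : embed₁ m n A = A ⊗ₖ (1 : Matrix n n ℂ) := rfl

theorem embed₂_apply (B : Matrix n n ℂ) : embed₂ m n B = (1 : Matrix m m ℂ) ⊗ₖ B := rfl

theorem commute_embed₁_embed₂ (A : Matrix m m ℂ) (B : Matrix n n ℂ) :
    Commute (embed₁ m n A) (embed₂ m n B) := by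
  rw [Commute, SemiconjBy, embed₁_apply, embed₂_apply, ← mul_kronecker_mul, ← mul_kronecker_mul]
  simp

theorem trace_embed₁_mul (ρ : State (m × n)) (z : Matrix m m ℂ) :
    (embed₁ m n z * ρ.toMatrix).trace = (z * ρ.reduced₁.toMatrix).trace := by
  simp only [trace, diag_apply, mul_apply, embed₁_apply, kroneckerMap_apply, State.reduced₁,
    partialTrace₂, of_apply, Fintype.sum_prod_type, one_apply, mul_ite, mul_one, mul_zero,
    ite_mul, zero_mul, Finset.sum_ite_eq, Finset.mem_univ, if_true, Finset.mul_sum]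
  exact Finset.sum_congr rfl fun i _ => Finset.sum_comm

theorem trace_embed₂_mul (ρ : State (m × n)) (z : Matrix n n ℂ) :
    (embed₂ m n z * ρ.toMatrix).trace = (z * ρ.reduced₂.toMatrix).trace := by
  simp only [trace, diag_apply, mul_apply, embed₂_apply, kroneckerMap_apply, State.reduced₂,
    partialTrace₁, of_apply, Fintype.sum_prod_type_right, one_apply, ite_mul, one_mul, zero_mul,
    Finset.sum_ite_eq, Finset.mem_univ, if_true, Finset.mul_sum]
  exact Finset.sum_congr rfl fun i _ => Finset.sum_comm

theorem State.nonempty (ρ : State m) : Nonempty m := by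
  by_contra h
  rw [not_nonempty_iff] at h
  have := ρ.trace_eq_one
  simp [trace] at this

theorem skewInformation_reduced₁_le {f : ℝ → ℝ} (hf : IsFop f) (hreg : IsRegular f)
    (ρ : State (m × n)) (A : Matrix m m ℂ) :
    skewInformation f ρ.reduced₁ A ≤ skewInformation f ρ (A ⊗ₖ (1 : Matrix n n ℂ)) := by
  have := ρ.reduced₂.nonempty
  exact skewInformation_le_of_restriction hf hreg (embed₁ m n) (trace_embed₁_mul ρ)
    (c := Fintype.card n) (by exact_mod_cast Fintype.card_pos)
    (fun z => by rw [embed₁_apply, trace_kronecker, trace_one, mul_comm, Complex.ofReal_natCast]) A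

theorem skewInformation_reduced₂_le {f : ℝ → ℝ} (hf : IsFop f) (hreg : IsRegular f)
    (ρ : State (m × n)) (B : Matrix n n ℂ) :
    skewInformation f ρ.reduced₂ B ≤ skewInformation f ρ ((1 : Matrix m m ℂ) ⊗ₖ B) := by
  have := ρ.reduced₁.nonempty
  exact skewInformation_le_of_restriction hf hreg (embed₂ m n) (trace_embed₂_mul ρ)
    (c := Fintype.card m) (by exact_mod_cast Fintype.card_pos)
    (fun z => by rw [embed₂_apply, trace_kronecker, trace_one, Complex.ofReal_natCast]) B

/-- If `ρ` is invariant under the pinching by the image of a von Neumann measurement under `Φ`,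
then the skew information is additive on `Φ A + Y` for `Y` commuting with the range of `Φ`. -/
theorem skewInformation_add_of_measurement {p : Type*} [Fintype p] [DecidableEq p] (f : ℝ → ℝ)
    (ρ : State p) (Φ : Matrix m m ℂ →⋆ₐ[ℂ] Matrix p p ℂ) {ι : Type*} [Fintype ι]
    {P : ι → Matrix m m ℂ} (hP : IsVonNeumannMeasurement P)
    (hρ : ∑ i, Φ (P i) * ρ.toMatrix * Φ (P i) = ρ.toMatrix) (A : Matrix m m ℂ)
    {Y : Matrix p p ℂ} (hY : ∀ z, Commute (Φ z) Yᴴ) :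
    skewInformation f ρ (Φ A + Y) = skewInformation f ρ (Φ A) + skewInformation f ρ Y := by
  classical
  have hsq : ∀ i, P i * P i = P i := fun i => (hP.isStarProjection i).isIdempotentElem
  have hmul : ∀ i j, Φ (P i) * Φ (P j) = if i = j then Φ (P i) else 0 := fun i j => by
    split_ifs with h
    · rw [← h, ← map_mul, hsq]
    · rw [← map_mul, hP.mul_eq_zero h, map_zero]
  refine skewInformation_add_of_pinching f ρ (R := fun i => Φ (P i)) (fun i => by simp [hmul])
    (by rw [← map_sum, hP.sum_eq_one, map_one]) (fun i => ?_) (fun i => ?_) (fun i => hY _)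
  · have hl : Φ (P i) * ρ.toMatrix = Φ (P i) * ρ.toMatrix * Φ (P i) := by
      conv_lhs => rw [← hρ, Finset.mul_sum]
      simp [← Matrix.mul_assoc, hmul]
    have hr : ρ.toMatrix * Φ (P i) = Φ (P i) * ρ.toMatrix * Φ (P i) := by
      conv_lhs => rw [← hρ, Finset.sum_mul]
      simp [Matrix.mul_assoc, hmul]
    exact hl.trans hr.symm
  · obtain ⟨a, ha⟩ := exists_mul_mul_eq_smul_of_rank_eq_one (hP.rank_eq_one i) A
    exact ⟨a, by rw [← map_mul, ← map_mul, ha, map_smul]⟩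

theorem State.IsSemiQuantum.skewInformation_add {ρ : State (m × n)} (hρ : ρ.IsSemiQuantum)
    (f : ℝ → ℝ) (A : Matrix m m ℂ) (B : Matrix n n ℂ) :
    skewInformation f ρ (A ⊗ₖ (1 : Matrix n n ℂ) + (1 : Matrix m m ℂ) ⊗ₖ B) =
      skewInformation f ρ (A ⊗ₖ (1 : Matrix n n ℂ)) +
        skewInformation f ρ ((1 : Matrix m m ℂ) ⊗ₖ B) := by
  rcases hρ with ⟨k, P, hP, h⟩ | ⟨k, Q, hQ, h⟩
  · refine skewInformation_add_of_measurement f ρ (embed₁ m n) hP h A fun z => ?_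
    rw [← embed₂_apply, ← star_eq_conjTranspose, ← map_star]
    exact commute_embed₁_embed₂ _ _
  · rw [add_comm, add_comm (skewInformation f ρ _)]
    refine skewInformation_add_of_measurement f ρ (embed₂ m n) hQ h B fun z => ?_
    rw [← embed₁_apply, ← star_eq_conjTranspose, ← map_star]
    exact (commute_embed₁_embed₂ _ _).symm

end BipartiteSystem

end SkewInfo

theorem mainTheorem2 {m n : Type*} [Fintype m] [DecidableEq m] [Fintype n] [DecidableEq n]
    (f : ℝ → ℝ) (hf : SkewInfo.IsFop f) (hreg : SkewInfo.IsRegular f)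
    (ρ : SkewInfo.State (m × n)) (hρ : ρ.IsSemiQuantum)
    (A : Matrix m m ℂ) (hA : A.IsHermitian) (B : Matrix n n ℂ) (hB : B.IsHermitian) :
    SkewInfo.skewInformation f ρ.reduced₁ A + SkewInfo.skewInformation f ρ.reduced₂ B ≤
      SkewInfo.skewInformation f ρ
        (A ⊗ₖ (1 : Matrix n n ℂ) + (1 : Matrix m m ℂ) ⊗ₖ B) := by
  rw [hρ.skewInformation_add]
  exact add_le_add (SkewInfo.skewInformation_reduced₁_le hf hreg ρ A)
    (SkewInfo.skewInformation_reduced₂_le hf hreg ρ B)
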